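/- Let $\Omega\subset\mathbb{R}^2$ be a bounded polygonal domain with Lipschitz boundary, and let $\{\mathcal{T}_h\}_{h\in(0,h_0)}$ be a family of conforming triangulations of $\Omega$, where $h$ is the largest diameter of an element of $\mathcal{T}_h$. Let $X_h$ be the space of continuous functions on $\overline\Omega$ that are affine on each element of $\mathcal{T}_h$, let $V_h=\{v\in X_h: v|_{\partial\Omega}=0\}$, and let $u(x_1,x_2)=x_1^2+x_2^2$, so that $-\Delta u=f$ with $f=-4$. For each $h$ let $g_h\in X_h$ be an arbitrary discrete Dirichlet lift (for example, the function in $X_h$ that equals $u$ at the boundary vertices and $0$ at the interior vertices), and let $U_h\in g_h+V_h$ be the finite element solution: $$\int_\Omega\nabla U_h\cdot\nabla v\,\mathrm{d}x=\int_\Omega f\,v\,\mathrm{d}x\qquad\text{for all } v\in V_h.$$ A straight band of length $L=(N+1)h$ of identical isosceles triangles with base length $h$ and height $\bar h>0$ consists of the triangles $K_i=P_iP_{i+1}Q_i$ $(0\le i\le N)$ and $\tilde K_i=Q_{i-1}Q_iP_i$ $(1\le i\le N)$, where $P_i=a+ih\,g$ and $Q_i=a+(i+\tfrac12)h\,g+\bar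 h\,n$ for some point $a$ and some orthonormal vectors $g,n$. Let $C_L>0$ be any fixed constant. Suppose that there is a sequence $h_k\to0$ in $(0,h_0)$ such that each $\mathcal{T}_{h_k}$ contains all the triangles of such a band, with base length $h_k$, length $L_k\ge C_L$ and height $\bar h_k$, where $\bar h_k=o(h_k^4)$ as $k\to\infty$. Then the finite element method does not converge in $H^1(\Omega)$ on $\{\mathcal{T}_h\}_{h\in(0,h_0)}$ for this $u$; more precisely, even the seminorm $$|u-U_h|_{H^1(\Omega)}=\Big(\int_\Omega|\nabla(u-U_h)|^2\,\mathrm{d}x\Big)^{1/2}$$ does not tend to $0$ as $h\to0$. -/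

import Mathlib

open Set Filter Topology MeasureTheory Asymptotics
open scoped NNReal ENNReal

noncomputable section

/-- The Euclidean plane. -/
abbrev Plane : Type := EuclideanSpace ℝ (Fin 2)

/-- `Ω` has Lipschitz boundary: near each boundary point, in suitable Cartesian coordinates,
`Ω` is the set of points strictly below the graph of a Lipschitz function. -/
def HasLipschitzBoundary (Ω : Set Plane) : Prop :=
  ∀ x ∈ frontier Ω, ∃ (A : Plane ≃ₗᵢ[ℝ] Plane) (φ : ℝ → ℝ) (C : ℝ≥0) (r : ℝ),
    0 < r ∧ LipschitzWith C φ ∧ ∀ y ∈ Metric.ball x r, (y ∈ Ω ↔ A y 1 < φ (A y 0))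

/-- A bounded polygonal domain with Lipschitz boundary in the plane. -/
structure IsPolygonalDomain (Ω : Set Plane) : Prop where
  isOpen : IsOpen Ω
  isConnected : IsConnected Ω
  isBounded : Bornology.IsBounded Ω
  polygonal : ∃ S : Set (Plane × Plane), S.Finite ∧ frontier Ω = ⋃ p ∈ S, segment ℝ p.1 p.2
  lipschitz : HasLipschitzBoundary Ω

/-- A conforming triangulation of `Ω`. An element is represented by its set `K` of three
vertices; the closed triangle itself is `convexHull ℝ K`. -/
structure Triangulation (Ω : Set Plane) where
  /-- the vertex sets of the elements -/
  elements : Set (Set Plane)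
  finite : elements.Finite
  /-- every element has three vertices -/
  ncard_eq : ∀ K ∈ elements, K.ncard = 3
  /-- no element is degenerate -/
  indep : ∀ K ∈ elements, AffineIndependent ℝ ((↑) : K → Plane)
  /-- two elements meet in the convex hull of their common vertices, that is, they are
  disjoint, or share exactly one vertex, or exactly one whole edge, or coincide -/
  conforming : ∀ K ∈ elements, ∀ K' ∈ elements,
    convexHull ℝ K ∩ convexHull ℝ K' = convexHull ℝ (K ∩ K')
  /-- the closed triangles cover exactly the closure of `Ω` -/
  cover : ⋃ K ∈ elements, convexHull ℝ K = closure Ω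

namespace Triangulation

variable {Ω : Set Plane}

/-- `h` is the mesh size of `T`, i.e. the largest diameter of an element. -/
def HasMeshSize (T : Triangulation Ω) (h : ℝ) : Prop :=
  IsGreatest ((fun K => Metric.diam (convexHull ℝ K)) '' T.elements) h

/-- The finite element space `X_h`: continuous functions on the closure of `Ω` that are affine
on each element. Values outside the closure of `Ω` play no role. -/
def femSpace (T : Triangulation Ω) : Set (Plane → ℝ) :=
  {v | ContinuousOn v (closure Ω) ∧
    ∀ K ∈ T.elements, ∃ (l : Plane →ₗ[ℝ] ℝ) (c : ℝ), ∀ x ∈ convexHull ℝ K, v x = l x + c}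

/-- The space `V_h` of the functions in `X_h` with zero boundary values. -/
def femSpace₀ (T : Triangulation Ω) : Set (Plane → ℝ) :=
  {v | v ∈ T.femSpace ∧ ∀ x ∈ frontier Ω, v x = 0}

/-- `U` is the finite element solution of `-Δ u = f` with discrete Dirichlet lift `g ∈ X_h`:
`U = U₀ + g` with `U₀ ∈ V_h` and `a(U, v) = (f, v)` for all `v ∈ V_h`, where
`a(U, v) = ∫_Ω ∇U · ∇v`. Functions in `X_h` are affine in the interior of each element, so
their weak gradient is almost everywhere the classical gradient used here. -/
def IsFEMSolution (T : Triangulation Ω) (f g U : Plane → ℝ) : Prop :=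
  (∃ U₀ ∈ T.femSpace₀, ∀ x, U x = U₀ x + g x) ∧
    ∀ v ∈ T.femSpace₀,
      ∫ x in Ω, inner ℝ (gradient U x) (gradient v x) = ∫ x in Ω, f x * v x

/-- `T` contains a straight band `K₀, K̃₁, K₁, …, K̃_N, K_N` of identical isosceles triangles of
base length `h` and height `hbar`. The vertices lie on two parallel lines with unit direction
`g` and unit normal `n`: the points `P i = a + i h g` on the line of the band's edge `Γ`, and
`Q i = a + (i + 1/2) h g + hbar n` on the opposite line. The triangles
`K_i = {P i, P (i+1), Q i}` have their bases on `Γ` (so `Γ` has length `(N + 1) h`), and the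
triangles `K̃_{i+1} = {Q i, Q (i+1), P (i+1)}` between `K_i` and `K_{i+1}` have their bases on
the opposite line. -/
def ContainsBand (T : Triangulation Ω) (h hbar : ℝ) (N : ℕ) : Prop :=
  ∃ a g n : Plane, ‖g‖ = 1 ∧ ‖n‖ = 1 ∧ inner ℝ g n = 0 ∧
    ∃ P Q : ℕ → Plane,
      (∀ i : ℕ, P i = a + ((i : ℝ) * h) • g) ∧
      (∀ i : ℕ, Q i = a + (((i : ℝ) + 1 / 2) * h) • g + hbar • n) ∧
      (∀ i ≤ N, {P i, P (i + 1), Q i} ∈ T.elements) ∧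
      (∀ i < N, {Q i, Q (i + 1), P (i + 1)} ∈ T.elements)

end Triangulation

/-- The `H¹(Ω)`-seminorm `|v|_1 = (∫_Ω |∇v|²)^{1/2}`, with values in `[0, ∞]`, of a function
whose weak gradient is almost everywhere its classical gradient (for instance, a continuous
and piecewise smooth function). -/
def h1Seminorm (Ω : Set Plane) (v : Plane → ℝ) : ℝ≥0∞ :=
  eLpNorm (gradient v) 2 (volume.restrict Ω)

/-- The exact solution `u(x₁, x₂) = x₁² + x₂²`, for which `-Δ u = -4`. -/
def quadSol (x : Plane) : ℝ := x 0 ^ 2 + x 1 ^ 2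

end

/-! The obstruction is one of approximation: a continuous piecewise affine function of bounded
energy cannot bend along the long edge `Γ` of a very flat band, whereas `u` does.

Suppose the error `w = u - U` tends to zero in the seminorm. Continuity across a leg of the band
bounds the jump of the tangential slope by `2 hbar / h` times normal derivatives. Summing along the
band and averaging over its middle third, all slopes on `Γ` differ from the first by at most `36 /
h²` times the integral of `|∇U|` over that third. Cauchy–Schwarz bounds this integral by `O(√hbar)`,
so `hbar = o(h⁴)` makes `U` asymptotically linear on `Γ` (`band_slope_step`, `band_nearly_linear`,
`tendsto_band_defect`).

Along any unit direction the second difference of `u` with step `m` is `2m²`, so that of `w` on `Γ`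
is at least `m²` for a fixed `m`. A trace inequality on a parallelogram of fixed size with one side
on `Γ` (`second_difference_le_lintegral`) then bounds the energy of `w` from below, a contradiction.
Compactness of the band positions and the Lipschitz boundary supply such parallelograms uniformly
along a subsequence, even if `Γ` lies on the boundary (`HasLipschitzBoundary.exists_direction`). -/

/-! ### Integrals along segments and over parallelograms -/

/-- The determinant of two vectors of the plane. -/
def cross (g e : Plane) : ℝ := g 0 * e 1 - g 1 * e 0

/-- Integrability of `f'` need not be assumed: if it fails, the right-hand side is infinite. -/
theorem enorm_sub_le_lintegral_of_hasDerivAt_off_countable {f f' : ℝ → ℝ} {a b : ℝ} (hab : a ≤ b)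
    (hc : ContinuousOn f (Icc a b)) {s : Set ℝ} (hs : s.Countable)
    (hd : ∀ x ∈ Ioo a b \ s, HasDerivAt f (f' x) x) (hm : Measurable f') :
    ‖f b - f a‖ₑ ≤ ∫⁻ x in Ioc a b, ‖f' x‖ₑ := by
  by_cases hfin : ∫⁻ x in Ioc a b, ‖f' x‖ₑ = ⊤
  · simp [hfin]
  have hint : IntervalIntegrable f' volume a b := by
    rw [intervalIntegrable_iff_integrableOn_Ioc_of_le hab]
    exact ⟨hm.aestronglyMeasurable, lt_top_iff_ne_top.2 hfin⟩
  rw [← integral_eq_of_hasDerivAt_off_countable_of_le f f' hab hs hc hd hint,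
    intervalIntegral.integral_of_le hab]
  exact enorm_integral_le_lintegral_enorm _

theorem lintegral_comp_parallelogram {G : Plane → ℝ≥0∞} (hG : Measurable G) (p : Plane)
    {g e : Plane} (hd : cross g e ≠ 0) :
    ∫⁻ z : ℝ × ℝ, G (p + z.1 • g + z.2 • e) =
      ENNReal.ofReal |cross g e|⁻¹ * ∫⁻ x, G x := by
  let M : Matrix (Fin 2) (Fin 2) ℝ := !![g 0, e 0; g 1, e 1]
  have hM : M.det = cross g e := by simp [M, Matrix.det_fin_two, cross]; ring
  have h1 := volume_preserving_finTwoArrow ℝ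
  have h2 := Real.map_matrix_volume_pi_eq_smul_volume_pi (M := M) (by rwa [hM])
  have h3 := PiLp.volume_preserving_toLp (Fin 2)
  have hG1 : Measurable fun z : ℝ × ℝ => G (p + z.1 • g + z.2 • e) :=
    hG.comp (by fun_prop)
  rw [← h1.lintegral_comp hG1, ← lintegral_add_left_eq_self G p]
  have hG2 : Measurable fun x => G (p + x) := hG.comp (by fun_prop)
  have hG3 : Measurable fun x : Fin 2 → ℝ => G (p + WithLp.toLp 2 x) :=
    hG2.comp h3.measurable
  rw [← h3.lintegral_comp hG2, ← smul_eq_mul, ← lintegral_smul_measure, ← abs_inv, ← hM, ← h2,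
    lintegral_map hG3 (Matrix.toLin' M).continuous_of_finiteDimensional.measurable]
  refine lintegral_congr fun x => ?_
  congr 1
  ext i
  fin_cases i <;>
    simp [M, Matrix.toLin'_apply, dotProduct, Fin.sum_univ_two,
      MeasurableEquiv.finTwoArrow] <;> ring

theorem measurable_gradient (w : Plane → ℝ) : Measurable (gradient w) :=
  (InnerProductSpace.toDual ℝ Plane).symm.continuous.measurable.comp (measurable_fderiv ℝ w)

theorem measurable_indicator_enorm_gradient {Ω : Set Plane} (hΩ : MeasurableSet Ω)
    (w : Plane → ℝ) : Measurable (Ω.indicator fun x => ‖gradient w x‖ₑ) :=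
  (measurable_gradient w).enorm.indicator hΩ

/-- Cauchy–Schwarz on the parameter rectangle. The square integral is then enlarged to the whole
plane, where the indicator of `Ω` leaves only the energy on `Ω`, and the Jacobian is `|cross g e|`.
-/
theorem lintegral_parallelogram_le {Ω : Set Plane} (hΩ : MeasurableSet Ω) (w : Plane → ℝ)
    (p : Plane) {g e : Plane} (hd : cross g e ≠ 0) (a a' c c' : ℝ) :
    ∫⁻ τ in Ioc c c', ∫⁻ s in Ioc a a',
        Ω.indicator (fun x => ‖gradient w x‖ₑ) (p + s • g + τ • e) ≤
      (ENNReal.ofReal |cross g e|⁻¹ * h1Seminorm Ω w ^ (2 : ℝ)) ^ (1 / 2 : ℝ) *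
        (ENNReal.ofReal (a' - a) * ENNReal.ofReal (c' - c)) ^ (1 / 2 : ℝ) := by
  set G := Ω.indicator fun x => ‖gradient w x‖ₑ with hGdef
  have hG : Measurable G := measurable_indicator_enorm_gradient hΩ w
  have hF : Measurable fun z : ℝ × ℝ => G (p + z.1 • g + z.2 • e) :=
    hG.comp (by fun_prop)
  have hE : ∫⁻ x, G x ^ (2 : ℝ) = h1Seminorm Ω w ^ (2 : ℝ) := by
    have : ∀ x, G x ^ (2 : ℝ) = Ω.indicator (fun x => ‖gradient w x‖ₑ ^ (2 : ℝ)) x := by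
      intro x
      by_cases hx : x ∈ Ω <;> simp [hGdef, hx]
    simp_rw [this]
    rw [lintegral_indicator hΩ, h1Seminorm,
      eLpNorm_eq_lintegral_rpow_enorm_toReal (by norm_num) (by norm_num), ← ENNReal.rpow_mul]
    norm_num
  have hvol : (volume.restrict (Ioc a a' ×ˢ Ioc c c')) univ =
      ENNReal.ofReal (a' - a) * ENNReal.ofReal (c' - c) := by
    rw [Measure.restrict_apply_univ, Measure.volume_eq_prod, Measure.prod_prod,
      Real.volume_Ioc, Real.volume_Ioc]
  rw [← hE, ← lintegral_comp_parallelogram (hG.pow_const _) p hd, ← hvol]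
  calc ∫⁻ τ in Ioc c c', ∫⁻ s in Ioc a a', G (p + s • g + τ • e)
      = ∫⁻ z in Ioc a a' ×ˢ Ioc c c', G (p + z.1 • g + z.2 • e) := by
        rw [Measure.volume_eq_prod, ← Measure.prod_restrict,
          lintegral_prod_symm _ hF.aemeasurable]
    _ ≤ (∫⁻ z in Ioc a a' ×ˢ Ioc c c', G (p + z.1 • g + z.2 • e) ^ (2 : ℝ)) ^ (1 / 2 : ℝ) *
          (∫⁻ _z in Ioc a a' ×ˢ Ioc c c', 1 ^ (2 : ℝ)) ^ (1 / 2 : ℝ) := by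
        have := ENNReal.lintegral_mul_le_Lp_mul_Lq (volume.restrict (Ioc a a' ×ˢ Ioc c c'))
          (Real.HolderConjugate.two_two) hF.aemeasurable
          (aemeasurable_const (b := (1 : ℝ≥0∞)))
        simpa using this
    _ ≤ _ := by
        simp only [ENNReal.one_rpow, lintegral_one]
        gcongr
        exact Measure.restrict_le_self

theorem eq_smul_add_smul_of_cross_ne_zero {g e : Plane} (hd : cross g e ≠ 0) (x : Plane) :
    x = (cross x e / cross g e) • g + (cross g x / cross g e) • e := by
  ext i
  simp only [cross] at *
  fin_cases i <;> simp only [Fin.zero_eta, Fin.mk_one, PiLp.add_apply, PiLp.smul_apply,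
    smul_eq_mul] <;> rw [div_mul_eq_mul_div, div_mul_eq_mul_div, ← add_div, eq_div_iff hd] <;> ring

theorem affine_apply_add_smul (f : Plane →ᵃ[ℝ] ℝ) (p g e : Plane) (s τ : ℝ) :
    f (p + s • g + τ • e) = f p + s * f.linear g + τ * f.linear e := by
  rw [add_comm (p + s • g), add_comm p, ← vadd_eq_add, f.map_vadd, ← vadd_eq_add, f.map_vadd]
  simp; ring

theorem finite_parallels {B : Set (Plane →ᵃ[ℝ] ℝ)} (hB : B.Finite) (hB0 : ∀ f ∈ B, f.linear ≠ 0)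
    (p : Plane) {g e : Plane} (hd : cross g e ≠ 0) :
    ∃ S : Set ℝ, S.Finite ∧ ∀ s ∉ S, ∃ S' : Set ℝ, S'.Finite ∧ ∀ τ ∉ S', ∀ f ∈ B,
      f (p + s • g + τ • e) ≠ 0 := by
  -- An `f` constant in direction `e` spoils a single `s`; any other `f` spoils a single `τ` for
  -- each `s`. Divisions by zero only add harmless points to the exceptional sets.
  refine ⟨(fun f : Plane →ᵃ[ℝ] ℝ => -f p / f.linear g) '' B, hB.image _, fun s hs =>
    ⟨(fun f : Plane →ᵃ[ℝ] ℝ => -(f p + s * f.linear g) / f.linear e) '' B, hB.image _,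
      fun τ hτ f hf h0 => ?_⟩⟩
  rw [affine_apply_add_smul] at h0
  by_cases he : f.linear e = 0
  · have hg : f.linear g ≠ 0 := by
      intro hg
      refine hB0 f hf (LinearMap.ext fun x => ?_)
      rw [eq_smul_add_smul_of_cross_ne_zero hd x]
      simp [he, hg]
    refine hs ⟨f, hf, ?_⟩
    simp only
    rw [he] at h0
    field_simp
    linarith
  · refine hτ ⟨f, hf, ?_⟩
    simp only
    field_simp
    linarith

theorem cross_swap (g e : Plane) : cross e g = -cross g e := by
  simp only [cross]; ring

/-! ### Geometry of the Lipschitz boundary -/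

theorem apply_le_of_mem_closure {Ω : Set Plane} {x : Plane} {A : Plane ≃ₗᵢ[ℝ] Plane} {φ : ℝ → ℝ}
    {r : ℝ} (hφ : Continuous φ) (h : ∀ y ∈ Metric.ball x r, (y ∈ Ω ↔ A y 1 < φ (A y 0)))
    {y : Plane} (hy : y ∈ closure Ω) (hyx : y ∈ Metric.ball x r) : A y 1 ≤ φ (A y 0) := by
  have h1 : y ∈ closure (Metric.ball x r ∩ Ω) := Metric.isOpen_ball.inter_closure ⟨hyx, hy⟩
  have h2 : IsClosed {y : Plane | A y 1 ≤ φ (A y 0)} :=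
    isClosed_le (by fun_prop) (hφ.comp (by fun_prop))
  exact closure_minimal (fun z hz => ((h z hz.1).1 hz.2).le) h2 h1

/-- The downward vertical unit vector in the Cartesian coordinates `A`. -/
noncomputable def downward (A : Plane ≃ₗᵢ[ℝ] Plane) : Plane := A.symm !₂[0, -1]

theorem norm_downward (A : Plane ≃ₗᵢ[ℝ] Plane) : ‖downward A‖ = 1 := by
  simp [downward, EuclideanSpace.norm_eq, Fin.sum_univ_two]

theorem apply_add_smul_downward_zero (A : Plane ≃ₗᵢ[ℝ] Plane) (y : Plane) (τ : ℝ) :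
    A (y + τ • downward A) 0 = A y 0 := by
  simp [downward]

theorem apply_add_smul_downward_one (A : Plane ≃ₗᵢ[ℝ] Plane) (y : Plane) (τ : ℝ) :
    A (y + τ • downward A) 1 = A y 1 - τ := by
  simp [downward]; ring

/-- A Lipschitz domain has no slits: points straight above a boundary point, in the local
coordinates, lie outside the closure. This places interiors of elements in `Ω`, although the
elements are only known to cover its closure. -/
theorem HasLipschitzBoundary.interior_closure_subset {Ω : Set Plane}
    (h : HasLipschitzBoundary Ω) (hO : IsOpen Ω) : interior (closure Ω) ⊆ Ω := by
  intro x hx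
  by_contra hxΩ
  have hxf : x ∈ frontier Ω := by
    rw [hO.frontier_eq]
    exact ⟨interior_subset hx, hxΩ⟩
  obtain ⟨A, φ, C, r, hr, hφ, hloc⟩ := h x hxf
  have hnb : interior (closure Ω) ∩ Metric.ball x r ∈ 𝓝 x :=
    inter_mem (isOpen_interior.mem_nhds hx) (Metric.ball_mem_nhds x hr)
  have ht : Tendsto (fun τ : ℝ => x + (-τ) • downward A) (𝓝[>] 0) (𝓝 x) := by
    have : Continuous fun τ : ℝ => x + (-τ) • downward A := by fun_prop
    have := (this.tendsto 0).mono_left (nhdsWithin_le_nhds (s := Ioi 0))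
    simpa using this
  obtain ⟨τ, hτ, hτ0⟩ := ((ht.eventually hnb).and self_mem_nhdsWithin).exists
  have h1 := apply_le_of_mem_closure hφ.continuous hloc (interior_subset hτ.1) hτ.2
  rw [apply_add_smul_downward_zero, apply_add_smul_downward_one] at h1
  have h2 := (hloc x (Metric.mem_ball_self hr)).not.1 hxΩ
  have h3 : (0 : ℝ) < τ := hτ0
  linarith

theorem exists_eq_smul_of_cross_eq_zero {g e : Plane} (hg : g ≠ 0) (h : cross g e = 0) :
    ∃ c : ℝ, e = c • g := by
  unfold cross at h
  by_cases h0 : g 0 = 0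
  · have h1 : g 1 ≠ 0 := by
      intro h1
      exact hg (by ext i; fin_cases i <;> simp [h0, h1])
    refine ⟨e 1 / g 1, ?_⟩
    have : e 0 = 0 := by
      rw [h0] at h
      have : g 1 * e 0 = 0 := by linarith
      exact (mul_eq_zero.1 this).resolve_left h1
    ext i
    fin_cases i <;> simp [h0, h1, this]
  · refine ⟨e 0 / g 0, ?_⟩
    ext i
    fin_cases i
    · simp [h0]
    · simp only [Fin.mk_one, PiLp.smul_apply, smul_eq_mul]
      field_simp
      linarith

/-- From all points near some interior point of a segment in the closure of a Lipschitz domain,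
one can move into the domain by a fixed distance in a fixed direction transversal to the segment. -/
theorem HasLipschitzBoundary.exists_direction {Ω : Set Plane} (h : HasLipschitzBoundary Ω)
    (hO : IsOpen Ω) {a g : Plane} (hg : ‖g‖ = 1) {L : ℝ} (hL : 0 < L)
    (hseg : ∀ s ∈ Ioo 0 L, a + s • g ∈ closure Ω) :
    ∃ s₀ ∈ Ioo 0 L, ∃ (e : Plane) (r : ℝ), 0 < r ∧ ‖e‖ = 1 ∧ cross g e ≠ 0 ∧
      ∀ y ∈ closure Ω, y ∈ Metric.ball (a + s₀ • g) r → ∀ τ ∈ Ioo 0 r, y + τ • e ∈ Ω := by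
  have hg0 : g ≠ 0 := by
    rintro rfl
    simp at hg
  have hdist : ∀ {e y x : Plane} {r τ : ℝ}, ‖e‖ = 1 → y ∈ Metric.ball x (r / 2) →
      τ ∈ Ioo 0 (r / 2) → y + τ • e ∈ Metric.ball x r := by
    intro e y x r τ he hy hτ
    rw [Metric.mem_ball, dist_eq_norm] at *
    calc ‖y + τ • e - x‖ = ‖(y - x) + τ • e‖ := by congr 1; abel
      _ ≤ ‖y - x‖ + ‖τ • e‖ := norm_add_le _ _
      _ < r / 2 + r / 2 := by
        rw [norm_smul, he, Real.norm_of_nonneg hτ.1.le, mul_one]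
        exact add_lt_add hy hτ.2
      _ = r := by ring
  -- If the segment meets `Ω`, a small step along its normal stays inside. Otherwise the open
  -- segment lies in the boundary, and the downward vertical of the local graph is used.
  by_cases hex : ∃ s₀ ∈ Ioo 0 L, a + s₀ • g ∈ Ω
  · obtain ⟨s₀, hs₀, hmem⟩ := hex
    obtain ⟨r, hr, hball⟩ := Metric.isOpen_iff.1 hO _ hmem
    have hsq : g 0 ^ 2 + g 1 ^ 2 = 1 := by
      have := EuclideanSpace.real_norm_sq_eq g
      rw [hg, Fin.sum_univ_two] at this
      linarith
    have he : ‖(!₂[-g 1, g 0] : Plane)‖ = 1 := by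
      rw [EuclideanSpace.norm_eq, Fin.sum_univ_two]
      simp only [Real.norm_eq_abs, sq_abs]
      simp only [Matrix.cons_val_zero, Matrix.cons_val_one]
      rw [neg_sq, add_comm, hsq, Real.sqrt_one]
    refine ⟨s₀, hs₀, !₂[-g 1, g 0], r / 2, by positivity, he, ?_, fun y _ hy τ hτ =>
      hball (hdist he hy hτ)⟩
    have : cross g !₂[-g 1, g 0] = 1 := by
      simp [cross]
      linarith
    rw [this]
    exact one_ne_zero
  · push Not at hex
    have hs₀ : L / 2 ∈ Ioo 0 L := ⟨by positivity, by linarith⟩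
    have hxf : a + (L / 2) • g ∈ frontier Ω := by
      rw [hO.frontier_eq]
      exact ⟨hseg _ hs₀, hex _ hs₀⟩
    obtain ⟨A, φ, C, r, hr, hφ, hloc⟩ := h _ hxf
    have key : ∀ y ∈ closure Ω, y ∈ Metric.ball (a + (L / 2) • g) (r / 2) →
        ∀ τ ∈ Ioo 0 (r / 2), y + τ • downward A ∈ Ω := by
      intro y hy hyb τ hτ
      refine (hloc _ (hdist (norm_downward A) hyb hτ)).2 ?_
      rw [apply_add_smul_downward_zero, apply_add_smul_downward_one]
      have := apply_le_of_mem_closure hφ.continuous hloc hy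
        (Metric.ball_subset_ball (by linarith) hyb)
      linarith [hτ.1]
    -- Were the downward direction parallel to `g`, a small step from the midpoint would reach a
    -- point of the segment lying in `Ω`, contrary to `hex`.
    refine ⟨L / 2, hs₀, downward A, r / 2, by positivity, norm_downward A, fun hc => ?_, key⟩
    obtain ⟨c, hc⟩ := exists_eq_smul_of_cross_eq_zero hg0 hc
    have ht : Tendsto (fun τ : ℝ => L / 2 + τ * c) (𝓝[>] 0) (𝓝 (L / 2)) := by
      have : Continuous fun τ : ℝ => L / 2 + τ * c := by fun_prop
      have := (this.tendsto 0).mono_left (nhdsWithin_le_nhds (s := Ioi 0))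
      simpa using this
    obtain ⟨τ, hτ1, hτ2⟩ := ((ht.eventually (Ioo_mem_nhds hs₀.1 hs₀.2)).and
      (Ioo_mem_nhdsGT (by positivity : (0 : ℝ) < r / 2))).exists
    have h1 := key _ (hseg _ hs₀) (Metric.mem_ball_self (by positivity)) τ hτ2
    rw [hc, smul_smul, add_assoc, ← add_smul] at h1
    exact hex _ hτ1 h1

/-! ### The skeleton of the mesh and a trace inequality -/

/-- `B` collects the barycentric coordinates of all elements: a point of a triangle at which none
vanishes has positive coordinates, hence is interior. Off these finitely many lines, finite element
functions have a classical gradient in `Ω`. -/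
theorem Triangulation.exists_skeleton {Ω : Set Plane} (T : Triangulation Ω) :
    ∃ B : Set (Plane →ᵃ[ℝ] ℝ), B.Finite ∧ (∀ f ∈ B, f.linear ≠ 0) ∧
      ∀ K ∈ T.elements, ∀ x ∈ convexHull ℝ K, (∀ f ∈ B, f x ≠ 0) → convexHull ℝ K ∈ 𝓝 x := by
  have hloc : ∀ K : T.elements, ∃ B : Set (Plane →ᵃ[ℝ] ℝ), B.Finite ∧ (∀ f ∈ B, f.linear ≠ 0) ∧
      ∀ x ∈ convexHull ℝ (K : Set Plane), (∀ f ∈ B, f x ≠ 0) →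
        convexHull ℝ (K : Set Plane) ∈ 𝓝 x := by
    rintro ⟨K, hK⟩
    have hcard := T.ncard_eq K hK
    have hfin : K.Finite := Set.finite_of_ncard_ne_zero (by omega)
    have : Fintype K := hfin.fintype
    have hcard' : Fintype.card K = 3 := by
      rw [← hcard, Set.ncard_eq_toFinset_card', Set.toFinset_card]
    have : Nontrivial K := Fintype.one_lt_card_iff_nontrivial.1 (by omega)
    have hspan : affineSpan ℝ (range ((↑) : K → Plane)) = ⊤ := by
      rw [(T.indep K hK).affineSpan_eq_top_iff_card_eq_finrank_add_one, hcard']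
      simp
    let b : AffineBasis K ℝ Plane := ⟨(↑), T.indep K hK, hspan⟩
    have hrange : range b = K := Subtype.range_coe
    refine ⟨range b.coord, finite_range _, ?_, fun x hx hB => ?_⟩
    · rintro _ ⟨i, rfl⟩ h0
      have hs := (b.coord i).linear_surjective_iff.mpr (b.surjective_coord i)
      obtain ⟨v, hv⟩ := hs 1
      rw [h0] at hv
      simp at hv
    · simp only at hx ⊢
      rw [← hrange] at hx ⊢
      rw [← mem_interior_iff_mem_nhds, b.interior_convexHull]
      rw [b.convexHull_eq_nonneg_coord] at hx
      exact fun i => lt_of_le_of_ne (hx i) (hB _ ⟨i, rfl⟩).symm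
  choose B hB1 hB2 hB3 using hloc
  have : Finite T.elements := T.finite
  refine ⟨⋃ K, B K, finite_iUnion hB1, ?_, ?_⟩
  · intro f hf
    obtain ⟨K, hK⟩ := mem_iUnion.1 hf
    exact hB2 K f hK
  · intro K hK x hx hf
    exact hB3 ⟨K, hK⟩ x hx fun f hfB => hf f (mem_iUnion.2 ⟨_, hfB⟩)

theorem hasDerivAt_comp_line {w : Plane → ℝ} {q e : Plane} {τ : ℝ}
    (h : DifferentiableAt ℝ w (q + τ • e)) :
    HasDerivAt (fun τ : ℝ => w (q + τ • e)) (inner ℝ (gradient w (q + τ • e)) e) τ := by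
  have h1 : HasDerivAt (fun τ : ℝ => q + τ • e) e τ := by
    simpa using ((hasDerivAt_id τ).smul_const e).const_add q
  exact h.hasGradientAt.hasFDerivAt.comp_hasDerivAt τ h1

/-- Only the open segment has to lie in `Ω`; an end point may sit on the boundary, where continuity
suffices. -/
theorem enorm_sub_le_lintegral_line {Ω : Set Plane} {w : Plane → ℝ}
    (hw : ContinuousOn w (closure Ω)) {B : Set (Plane →ᵃ[ℝ] ℝ)}
    (hdiff : ∀ x ∈ Ω, (∀ f ∈ B, f x ≠ 0) → DifferentiableAt ℝ w x) {q e : Plane} (he : ‖e‖ = 1)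
    {a b : ℝ} (hab : a ≤ b) (hcl : ∀ τ ∈ Icc a b, q + τ • e ∈ closure Ω)
    (hin : ∀ τ ∈ Ioo a b, q + τ • e ∈ Ω) {S : Set ℝ} (hS : S.Finite)
    (hSB : ∀ τ ∉ S, ∀ f ∈ B, f (q + τ • e) ≠ 0) :
    ‖w (q + b • e) - w (q + a • e)‖ₑ ≤
      ∫⁻ τ in Ioc a b, Ω.indicator (fun x => ‖gradient w x‖ₑ) (q + τ • e) := by
  have hm : Measurable fun τ : ℝ => inner ℝ (gradient w (q + τ • e)) e :=
    Measurable.inner ((measurable_gradient w).comp (by fun_prop)) measurable_const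
  refine (enorm_sub_le_lintegral_of_hasDerivAt_off_countable
    (f := fun τ : ℝ => w (q + τ • e)) hab
    (hw.comp (by fun_prop) hcl) hS.countable (fun τ hτ =>
      hasDerivAt_comp_line (hdiff _ (hin τ hτ.1) (hSB τ hτ.2))) hm).trans ?_
  rw [← setLIntegral_congr (Ioo_ae_eq_Ioc (μ := volume)),
    ← setLIntegral_congr (Ioo_ae_eq_Ioc (μ := volume))]
  refine setLIntegral_mono' measurableSet_Ioo fun τ hτ => ?_
  rw [indicator_of_mem (hin τ hτ), ← ofReal_norm, ← ofReal_norm]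
  refine ENNReal.ofReal_le_ofReal ?_
  simpa [he] using abs_real_inner_le_norm (gradient w (q + τ • e)) e

theorem setLIntegral_comp_add_right_le (V : ℝ → ℝ≥0∞) (hV : Measurable V) {m b c : ℝ}
    (hc : 0 ≤ c) (hb : m + c ≤ b) :
    ∫⁻ s in Ioc 0 m, V (s + c) ≤ ∫⁻ s in Ioc 0 b, V s := by
  rw [← (measurePreserving_add_right volume c).setLIntegral_comp_preimage measurableSet_Ioc hV]
  refine lintegral_mono_set fun s hs => ?_
  exact ⟨by linarith [hs.1], by linarith [hs.2]⟩

/-- A trace inequality: the second differences of `w` along one side of a parallelogram are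
controlled by the integral of its gradient over the parallelogram. -/
theorem second_difference_le_lintegral {Ω : Set Plane} (hO : IsOpen Ω) {w : Plane → ℝ}
    (hw : ContinuousOn w (closure Ω)) {B : Set (Plane →ᵃ[ℝ] ℝ)} (hB : B.Finite)
    (hB0 : ∀ f ∈ B, f.linear ≠ 0)
    (hdiff : ∀ x ∈ Ω, (∀ f ∈ B, f x ≠ 0) → DifferentiableAt ℝ w x) {p g e : Plane}
    (hg : ‖g‖ = 1) (he : ‖e‖ = 1) (hd : cross g e ≠ 0) {m δ : ℝ} (hm : 0 < m)
    (hcl : ∀ s ∈ Icc 0 (3 * m), p + s • g ∈ closure Ω)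
    (hin : ∀ s ∈ Icc 0 (3 * m), ∀ τ ∈ Ioc 0 δ, p + s • g + τ • e ∈ Ω) {c : ℝ≥0∞}
    (hc : ∀ s ∈ Icc 0 m,
      c ≤ ‖w (p + s • g) - 2 * w (p + (s + m) • g) + w (p + (s + 2 * m) • g)‖ₑ) :
    c * ENNReal.ofReal m * ENNReal.ofReal δ ≤
      (ENNReal.ofReal m + 4 * ENNReal.ofReal δ) *
        ∫⁻ τ in Ioc 0 δ, ∫⁻ s in Ioc 0 (3 * m),
          Ω.indicator (fun x => ‖gradient w x‖ₑ) (p + s • g + τ • e) := by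
  set G := Ω.indicator fun x => ‖gradient w x‖ₑ with hGdef
  have hG : Measurable G := measurable_indicator_enorm_gradient hO.measurableSet w
  have hF : Measurable fun z : ℝ × ℝ => G (p + z.1 • g + z.2 • e) :=
    hG.comp (by fun_prop)
  set V : ℝ → ℝ≥0∞ := fun s => ∫⁻ τ in Ioc 0 δ, G (p + s • g + τ • e) with hV
  set H : ℝ → ℝ≥0∞ := fun τ => ∫⁻ s in Ioc 0 (3 * m), G (p + s • g + τ • e) with hH
  have hVm : Measurable V := hF.lintegral_prod_right'
  have hHm : Measurable H := hF.lintegral_prod_left'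
  set I := ∫⁻ τ in Ioc 0 δ, H τ with hI
  have hVI : ∫⁻ s in Ioc 0 (3 * m), V s = I :=
    lintegral_lintegral_swap (f := fun s τ => G (p + s • g + τ • e)) hF.aemeasurable
  obtain ⟨S, hS, hSB⟩ := finite_parallels hB hB0 p hd
  obtain ⟨S', hS', hSB'⟩ := finite_parallels hB hB0 p (g := e) (e := g)
    (by rwa [cross_swap, neg_ne_zero])
  have vert : ∀ s ∈ Icc 0 (3 * m), s ∉ S → ∀ τ ∈ Ioc 0 δ,
      ‖w (p + s • g + τ • e) - w (p + s • g)‖ₑ ≤ V s := by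
    intro s hs hsS τ hτ
    obtain ⟨R, hR, hRB⟩ := hSB s hsS
    have := enorm_sub_le_lintegral_line hw hdiff (q := p + s • g) he hτ.1.le
      (fun t ht => by
        rcases ht.1.eq_or_lt with h0 | h0
        · rw [← h0]
          simpa using hcl s hs
        · exact subset_closure (hin s hs t ⟨h0, ht.2.trans hτ.2⟩))
      (fun t ht => hin s hs t ⟨ht.1, ht.2.le.trans hτ.2⟩) hR hRB
    rw [zero_smul, add_zero] at this
    exact this.trans (lintegral_mono_set (Ioc_subset_Ioc_right hτ.2))
  have horiz : ∀ τ ∈ Ioc 0 δ, τ ∉ S' → ∀ s, 0 ≤ s → s + m ≤ 3 * m →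
      ‖w (p + (s + m) • g + τ • e) - w (p + s • g + τ • e)‖ₑ ≤
        ∫⁻ t in Ioc s (s + m), G (p + t • g + τ • e) := by
    intro τ hτ hτS s hs0 hs1
    obtain ⟨R, hR, hRB⟩ := hSB' τ hτS
    have hin' : ∀ t ∈ Icc s (s + m), p + τ • e + t • g ∈ Ω := fun t ht => by
      rw [add_right_comm]
      exact hin t ⟨hs0.trans ht.1, ht.2.trans hs1⟩ τ hτ
    have := enorm_sub_le_lintegral_line hw hdiff (q := p + τ • e) hg (a := s) (b := s + m)
      (by linarith) (fun t ht => subset_closure (hin' t ht))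
      (fun t ht => hin' t (Ioo_subset_Icc_self ht)) hR hRB
    simpa only [add_right_comm p (τ • e)] using this
  -- The second difference is transported from height `0` to height `τ` at the cost of the vertical
  -- increments. At height `τ` it is a difference of increments over two adjacent intervals, which
  -- together cost at most `H τ`.
  have point : ∀ s ∈ Icc 0 m, s ∉ S → s + m ∉ S → s + 2 * m ∉ S → ∀ τ ∈ Ioc 0 δ, τ ∉ S' →
      c ≤ H τ + (V s + 2 * V (s + m) + V (s + 2 * m)) := by
    intro s hs h1 h2 h3 τ hτ hτS
    have v1 := vert s ⟨hs.1, by linarith [hs.2]⟩ h1 τ hτ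
    have v2 := vert (s + m) ⟨by linarith [hs.1], by linarith [hs.2]⟩ h2 τ hτ
    have v3 := vert (s + 2 * m) ⟨by linarith [hs.1], by linarith [hs.2]⟩ h3 τ hτ
    have k1 := horiz τ hτ hτS s hs.1 (by linarith [hs.2])
    have k2 := horiz τ hτ hτS (s + m) (by linarith [hs.1]) (by linarith [hs.2])
    rw [show s + m + m = s + 2 * m by ring] at k2
    have k : (∫⁻ t in Ioc s (s + m), G (p + t • g + τ • e)) +
        ∫⁻ t in Ioc (s + m) (s + 2 * m), G (p + t • g + τ • e) ≤ H τ := by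
      rw [← lintegral_union measurableSet_Ioc (Ioc_disjoint_Ioc_of_le le_rfl),
        Ioc_union_Ioc_eq_Ioc (by linarith) (by linarith)]
      exact lintegral_mono_set (Ioc_subset_Ioc hs.1 (by linarith [hs.2]))
    set x0 := w (p + s • g)
    set x1 := w (p + (s + m) • g)
    set x2 := w (p + (s + 2 * m) • g)
    set y0 := w (p + s • g + τ • e)
    set y1 := w (p + (s + m) • g + τ • e)
    set y2 := w (p + (s + 2 * m) • g + τ • e)
    calc c ≤ ‖x0 - 2 * x1 + x2‖ₑ := hc s hs
      _ = ‖((y2 - y1) - (y1 - y0)) + (((2 : ℝ) * (y1 - x1) - (y0 - x0)) - (y2 - x2))‖ₑ := by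
        congr 1; ring
      _ ≤ (‖y2 - y1‖ₑ + ‖y1 - y0‖ₑ) +
          ((‖(2 : ℝ)‖ₑ * ‖y1 - x1‖ₑ + ‖y0 - x0‖ₑ) + ‖y2 - x2‖ₑ) := by
        refine (enorm_add_le _ _).trans (add_le_add enorm_sub_le (enorm_sub_le.trans ?_))
        gcongr
        refine enorm_sub_le.trans ?_
        rw [enorm_mul]
      _ ≤ H τ + ((2 * V (s + m) + V s) + V (s + 2 * m)) := by
        gcongr
        · rw [add_comm]
          exact (add_le_add k1 k2).trans k
        · rw [← ofReal_norm]
          simp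
      _ = _ := by ring
  have slice : ∀ s ∈ Icc 0 m, s ∉ S → s + m ∉ S → s + 2 * m ∉ S →
      c * ENNReal.ofReal δ ≤ I + ENNReal.ofReal δ * (V s + 2 * V (s + m) + V (s + 2 * m)) := by
    intro s hs h1 h2 h3
    calc c * ENNReal.ofReal δ = ∫⁻ _τ in Ioc 0 δ, c := by simp
      _ ≤ ∫⁻ τ in Ioc 0 δ, (H τ + (V s + 2 * V (s + m) + V (s + 2 * m))) := by
        refine setLIntegral_mono_ae (by fun_prop) ?_
        filter_upwards [hS'.countable.ae_notMem volume] with τ hτS hτ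
        exact point s hs h1 h2 h3 τ hτ hτS
      _ = _ := by
        rw [lintegral_add_right _ measurable_const]
        simp [hI, mul_comm]
  calc c * ENNReal.ofReal m * ENNReal.ofReal δ = ∫⁻ _s in Ioc 0 m, c * ENNReal.ofReal δ := by
        simp; ring
    _ ≤ ∫⁻ s in Ioc 0 m,
        (I + ENNReal.ofReal δ * (V s + 2 * V (s + m) + V (s + 2 * m))) := by
      refine setLIntegral_mono_ae (by fun_prop) ?_
      have hinj : ∀ t : ℝ, ∀ᵐ s : ℝ, s + t ∉ S := fun t =>
        ((hS.preimage (add_left_injective t).injOn).countable).ae_notMem volume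
      filter_upwards [hS.countable.ae_notMem volume, hinj m, hinj (2 * m)] with s h1 h2 h3 hs
      exact slice s (Ioc_subset_Icc_self hs) h1 h2 h3
    _ = I * ENNReal.ofReal m + ENNReal.ofReal δ * ((∫⁻ s in Ioc 0 m, V s) +
        2 * (∫⁻ s in Ioc 0 m, V (s + m)) + ∫⁻ s in Ioc 0 m, V (s + 2 * m)) := by
      rw [lintegral_add_left measurable_const, lintegral_const_mul _ (by fun_prop),
        lintegral_add_right _ (by fun_prop), lintegral_add_right _ (by fun_prop),
        lintegral_const_mul _ (by fun_prop)]
      simp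
    -- All translates stay in `[0, 3m]`, so each integral of `V` is at most `I`; the weights `1, 2,
    -- 1` of the second difference add up to the factor `4`.
    _ ≤ I * ENNReal.ofReal m + ENNReal.ofReal δ * (I + 2 * I + I) := by
      have a0 := setLIntegral_comp_add_right_le V hVm (m := m) (b := 3 * m) le_rfl (by linarith)
      have a1 := setLIntegral_comp_add_right_le V hVm (m := m) (b := 3 * m) hm.le (by linarith)
      have a2 := setLIntegral_comp_add_right_le V hVm (m := m) (b := 3 * m) (c := 2 * m)
        (by linarith) (by linarith)
      simp only [add_zero] at a0
      rw [hVI] at a0 a1 a2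
      gcongr
    _ = _ := by ring

/-! ### Slopes of a finite element function along the band -/

theorem mem_convexHull_triple {A B C x : Plane} {α β γ : ℝ} (hα : 0 ≤ α) (hβ : 0 ≤ β) (hγ : 0 ≤ γ)
    (hsum : α + β + γ = 1) (hx : x = α • A + β • B + γ • C) : x ∈ convexHull ℝ {A, B, C} := by
  have := (convex_convexHull ℝ ({A, B, C} : Set Plane)).sum_mem (t := Finset.univ)
    (w := ![α, β, γ]) (z := ![A, B, C])
    (by intro i _; fin_cases i <;> simpa) (by simpa [Fin.sum_univ_three] using hsum)
    (by intro i _; fin_cases i <;> exact subset_convexHull ℝ _ (by simp))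
  rw [hx]
  simpa [Fin.sum_univ_three] using this

theorem hasGradientAt_of_eqOn_affine {U : Plane → ℝ} {D : Set Plane} {l : Plane →ₗ[ℝ] ℝ} {c : ℝ}
    (hU : ∀ x ∈ D, U x = l x + c) {x : Plane} (hx : D ∈ 𝓝 x) :
    DifferentiableAt ℝ U x ∧ ∀ v, l v = inner ℝ (gradient U x) v := by
  have h1 : HasFDerivAt U (LinearMap.toContinuousLinearMap l) x := by
    refine HasFDerivAt.congr_of_eventuallyEq
      ((LinearMap.toContinuousLinearMap l).hasFDerivAt.add_const c) ?_
    filter_upwards [hx] with y hy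
    simpa using hU y hy
  refine ⟨h1.differentiableAt, fun v => ?_⟩
  rw [gradient, h1.fderiv]
  simp

theorem Triangulation.convexHull_subset_closure {Ω : Set Plane} (T : Triangulation Ω) {K : Set Plane}
    (hK : K ∈ T.elements) : convexHull ℝ K ⊆ closure Ω := by
  rw [← T.cover]
  exact subset_biUnion_of_mem (u := fun K => convexHull ℝ K) hK

/-- The normal derivative is constant on `K`, and all but finitely many points of the chord are
interior to `K`, where it is dominated by `G`. -/
theorem ofReal_mul_enorm_le_lintegral {Ω : Set Plane} (hΩ : interior (closure Ω) ⊆ Ω)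
    (T : Triangulation Ω) {B : Set (Plane →ᵃ[ℝ] ℝ)}
    (hTB : ∀ K ∈ T.elements, ∀ x ∈ convexHull ℝ K, (∀ f ∈ B, f x ≠ 0) → convexHull ℝ K ∈ 𝓝 x)
    {U : Plane → ℝ} {G : Plane → ℝ≥0∞} (hG : Measurable G)
    (hUG : ∀ x ∈ Ω, DifferentiableAt ℝ U x → ‖gradient U x‖ₑ ≤ G x) {q g n : Plane}
    (hn : ‖n‖ = 1) {S : Set ℝ} (hS : S.Finite) (hSB : ∀ s ∉ S, ∀ f ∈ B, f (q + s • g) ≠ 0)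
    {K : Set Plane} (hK : K ∈ T.elements) {l : Plane →ₗ[ℝ] ℝ} {c : ℝ}
    (hU : ∀ x ∈ convexHull ℝ K, U x = l x + c) {α β : ℝ}
    (hmem : ∀ s ∈ Icc α β, q + s • g ∈ convexHull ℝ K) :
    ENNReal.ofReal (β - α) * ‖l n‖ₑ ≤ ∫⁻ s in Ioc α β, G (q + s • g) := by
  calc ENNReal.ofReal (β - α) * ‖l n‖ₑ = ∫⁻ _s in Ioc α β, ‖l n‖ₑ := by simp [mul_comm]
    _ ≤ _ := by
      refine setLIntegral_mono_ae (hG.comp (by fun_prop)).aemeasurable ?_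
      filter_upwards [hS.countable.ae_notMem volume] with s hs hsI
      have hx := hmem s (Ioc_subset_Icc_self hsI)
      have hnb := hTB K hK _ hx (hSB s hs)
      have hxΩ := hΩ (mem_interior_iff_mem_nhds.2
        (mem_of_superset hnb (T.convexHull_subset_closure hK)))
      obtain ⟨h1, h2⟩ := hasGradientAt_of_eqOn_affine hU hnb
      refine le_trans ?_ (hUG _ hxΩ h1)
      rw [h2 n, ← ofReal_norm, ← ofReal_norm]
      refine ENNReal.ofReal_le_ofReal ?_
      simpa [hn] using abs_real_inner_le_norm (gradient U (q + s • g)) n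

/-- Two affine functions agreeing at the two end points of the leg shared by two consecutive
triangles of a band have tangential slopes that differ by a multiple of the aspect ratio. -/
theorem abs_sub_le_of_leg {l l' : Plane →ₗ[ℝ] ℝ} {c c' : ℝ} {x y g n : Plane} {h hbar : ℝ}
    (hh : 0 < h) (hb : 0 < hbar) (hx : l x + c = l' x + c') (hy : l y + c = l' y + c')
    (hxy : y - x = (h / 2) • g + hbar • n ∨ y - x = -((h / 2) • g) + hbar • n) :
    |l' g - l g| ≤ 2 * hbar / h * (|l n| + |l' n|) := by
  have h0 : l (y - x) = l' (y - x) := by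
    rw [map_sub, map_sub]
    linarith
  -- Both linear parts agree on the leg vector, so a tangential jump over `h / 2` is balanced by a
  -- normal jump over `hbar`.
  have h1 : |h / 2 * (l' g - l g)| = |hbar * (l n - l' n)| := by
    rcases hxy with hxy | hxy
    · rw [hxy] at h0
      simp only [map_add, map_smul, smul_eq_mul] at h0
      congr 1
      linarith
    · rw [hxy] at h0
      simp only [map_add, map_smul, smul_eq_mul, map_neg] at h0
      rw [← abs_neg]
      congr 1
      linarith
  rw [abs_mul, abs_mul, abs_of_pos hb, abs_of_pos (by positivity : 0 < h / 2)] at h1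
  have h2 : |l n - l' n| ≤ |l n| + |l' n| := abs_sub _ _
  have h3 : |l' g - l g| = 2 * hbar / h * |l n - l' n| := by
    field_simp
    linarith
  rw [h3]
  gcongr

/-- Passing from `K_i` to `K_{i+1}` crosses two legs, through the inverted triangle between them.
The integration interval runs from the centre of one base to the centre of the next, so that
consecutive steps add up without overlap. -/
theorem band_slope_step {Ω : Set Plane} (hΩ : interior (closure Ω) ⊆ Ω)
    (T : Triangulation Ω) {B : Set (Plane →ᵃ[ℝ] ℝ)}
    (hTB : ∀ K ∈ T.elements, ∀ x ∈ convexHull ℝ K, (∀ f ∈ B, f x ≠ 0) → convexHull ℝ K ∈ 𝓝 x)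
    {U : Plane → ℝ} {G : Plane → ℝ≥0∞} (hG : Measurable G)
    (hUG : ∀ x ∈ Ω, DifferentiableAt ℝ U x → ‖gradient U x‖ₑ ≤ G x) {a g n : Plane}
    (hn : ‖n‖ = 1) {h hbar τ : ℝ} (hh : 0 < h) (hb : 0 < hbar)
    (hτ : τ ∈ Ioc (hbar / 3) (2 * hbar / 3)) {S : Set ℝ} (hS : S.Finite)
    (hSB : ∀ s ∉ S, ∀ f ∈ B, f (a + τ • n + s • g) ≠ 0) {P Q : ℕ → Plane}
    (hP : ∀ i : ℕ, P i = a + ((i : ℝ) * h) • g)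
    (hQ : ∀ i : ℕ, Q i = a + (((i : ℝ) + 1 / 2) * h) • g + hbar • n) {i : ℕ}
    (hK : {P i, P (i + 1), Q i} ∈ T.elements)
    (hK' : {P (i + 1), P (i + 1 + 1), Q (i + 1)} ∈ T.elements)
    (hKt : {Q i, Q (i + 1), P (i + 1)} ∈ T.elements) {l l' lt : Plane →ₗ[ℝ] ℝ} {c c' ct : ℝ}
    (hU : ∀ x ∈ convexHull ℝ {P i, P (i + 1), Q i}, U x = l x + c)
    (hU' : ∀ x ∈ convexHull ℝ {P (i + 1), P (i + 1 + 1), Q (i + 1)}, U x = l' x + c')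
    (hUt : ∀ x ∈ convexHull ℝ {Q i, Q (i + 1), P (i + 1)}, U x = lt x + ct) :
    ‖l' g - l g‖ₑ ≤ ENNReal.ofReal (12 * hbar / h ^ 2) *
      ∫⁻ s in Ioc (((i : ℝ) + 1 / 2) * h) (((i + 1 : ℕ) + 1 / 2) * h), G (a + τ • n + s • g) := by
  set θ := τ / hbar with hθ
  have hτθ : τ = θ * hbar := by rw [hθ]; field_simp
  have hθ1 : 1 / 3 ≤ θ := by rw [hθ, le_div_iff₀ hb]; linarith [hτ.1]
  have hθ2 : θ ≤ 2 / 3 := by rw [hθ, div_le_iff₀ hb]; linarith [hτ.2]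
  -- At relative height `θ` the chord of `K_j` is `[j + θ/2, j + 1 - θ/2]` in units of `h`, and that
  -- of the inverted triangle is `[i + 1 - θ/2, i + 1 + θ/2]`. For `θ` in `[1/3, 2/3]` both contain
  -- a fixed interval of length `1/3`.
  have memK : ∀ j : ℕ, ∀ s ∈ Icc (((j : ℝ) + 1 / 3) * h) (((j : ℝ) + 2 / 3) * h),
      a + τ • n + s • g ∈ convexHull ℝ {P j, P (j + 1), Q j} := by
    intro j s hs
    obtain ⟨σ, rfl⟩ : ∃ σ, s = σ * h := ⟨s / h, by field_simp⟩
    have hs1 := le_of_mul_le_mul_right hs.1 hh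
    have hs2 := le_of_mul_le_mul_right hs.2 hh
    refine mem_convexHull_triple (α := 1 - θ - (σ - j - θ / 2)) (β := σ - j - θ / 2) (γ := θ)
      (by linarith) (by linarith) (by linarith) (by ring) ?_
    rw [hP, hP, hQ, hτθ]
    push_cast
    module
  have memKt : ∀ s ∈ Icc (((i : ℝ) + 5 / 6) * h) (((i : ℝ) + 7 / 6) * h),
      a + τ • n + s • g ∈ convexHull ℝ {Q i, Q (i + 1), P (i + 1)} := by
    intro s hs
    obtain ⟨σ, rfl⟩ : ∃ σ, s = σ * h := ⟨s / h, by field_simp⟩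
    have hs1 := le_of_mul_le_mul_right hs.1 hh
    have hs2 := le_of_mul_le_mul_right hs.2 hh
    refine mem_convexHull_triple (α := θ - (σ - i - 1 + θ / 2)) (β := σ - i - 1 + θ / 2)
      (γ := 1 - θ) (by linarith) (by linarith) (by linarith) (by ring) ?_
    rw [hP, hQ, hQ, hτθ]
    push_cast
    module
  have b1 := ofReal_mul_enorm_le_lintegral hΩ T hTB hG hUG hn hS hSB hK hU
    (α := ((i : ℝ) + 1 / 2) * h) (β := ((i : ℝ) + 2 / 3) * h)
    (fun s hs => memK i s ⟨by nlinarith [hs.1], hs.2⟩)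
  have b2 := ofReal_mul_enorm_le_lintegral hΩ T hTB hG hUG hn hS hSB hKt hUt memKt
  have b3 := ofReal_mul_enorm_le_lintegral hΩ T hTB hG hUG hn hS hSB hK' hU'
    (α := (((i + 1 : ℕ) : ℝ) + 1 / 3) * h) (β := (((i + 1 : ℕ) : ℝ) + 1 / 2) * h)
    (fun s hs => memK (i + 1) s ⟨hs.1, by nlinarith [hs.2]⟩)
  have hpt : ∀ {X : Set Plane} {x : Plane}, x ∈ X → x ∈ convexHull ℝ X :=
    fun hx => subset_convexHull ℝ _ hx
  have e1 : |lt g - l g| ≤ 2 * hbar / h * (|l n| + |lt n|) :=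
    abs_sub_le_of_leg (x := P (i + 1)) (y := Q i) (c := c) (c' := ct) hh hb
      (by rw [← hU _ (hpt (by simp)), ← hUt _ (hpt (by simp))])
      (by rw [← hU _ (hpt (by simp)), ← hUt _ (hpt (by simp))])
      (Or.inr (by rw [hP, hQ]; push_cast; module))
  have e2 : |l' g - lt g| ≤ 2 * hbar / h * (|lt n| + |l' n|) :=
    abs_sub_le_of_leg (x := P (i + 1)) (y := Q (i + 1)) (c := ct) (c' := c') hh hb
      (by rw [← hU' _ (hpt (by simp)), ← hUt _ (hpt (by simp))])
      (by rw [← hU' _ (hpt (by simp)), ← hUt _ (hpt (by simp))])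
      (Or.inl (by rw [hP, hQ]; push_cast; module))
  -- The weights `h/6, h/3, h/6` are the lengths of the chord pieces in `b1`, `b2`, `b3`: only half
  -- of the central chord of each upright triangle is used, the other half being left to the
  -- neighbouring step.
  have e3 : |l' g - l g| ≤
      12 * hbar / h ^ 2 * (h / 6 * |l n| + h / 3 * |lt n| + h / 6 * |l' n|) := by
    calc |l' g - l g| ≤ |l' g - lt g| + |lt g - l g| := abs_sub_le _ _ _
      _ ≤ 2 * hbar / h * (|lt n| + |l' n|) + 2 * hbar / h * (|l n| + |lt n|) := add_le_add e2 e1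
      _ = _ := by field_simp; ring
  have hjoin : (∫⁻ s in Ioc (((i : ℝ) + 1 / 2) * h) (((i : ℝ) + 2 / 3) * h),
        G (a + τ • n + s • g)) +
      (∫⁻ s in Ioc (((i : ℝ) + 5 / 6) * h) (((i : ℝ) + 7 / 6) * h), G (a + τ • n + s • g)) +
      (∫⁻ s in Ioc ((((i + 1 : ℕ) : ℝ) + 1 / 3) * h) ((((i + 1 : ℕ) : ℝ) + 1 / 2) * h),
        G (a + τ • n + s • g)) ≤
      ∫⁻ s in Ioc (((i : ℝ) + 1 / 2) * h) (((i + 1 : ℕ) + 1 / 2) * h),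
        G (a + τ • n + s • g) := by
    push_cast
    have d1 : ((i : ℝ) + 2 / 3) * h ≤ ((i : ℝ) + 5 / 6) * h := by nlinarith
    have d2 : ((i : ℝ) + 7 / 6) * h ≤ ((i : ℝ) + 1 + 1 / 3) * h := by nlinarith
    rw [← lintegral_union measurableSet_Ioc (Ioc_disjoint_Ioc_of_le d1),
      ← lintegral_union measurableSet_Ioc]
    · refine lintegral_mono_set ?_
      refine union_subset (union_subset ?_ ?_) ?_ <;> refine Ioc_subset_Ioc ?_ ?_ <;> nlinarith
    · rw [disjoint_union_left]
      exact ⟨Ioc_disjoint_Ioc_of_le (by nlinarith), Ioc_disjoint_Ioc_of_le d2⟩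
  rw [← ofReal_norm, Real.norm_eq_abs]
  refine (ENNReal.ofReal_le_ofReal e3).trans ?_
  rw [ENNReal.ofReal_mul (by positivity)]
  gcongr
  refine le_trans (le_of_eq ?_) ((add_le_add (add_le_add b1 b2) b3).trans hjoin)
  rw [ENNReal.ofReal_add (by positivity) (by positivity),
    ENNReal.ofReal_add (by positivity) (by positivity), ENNReal.ofReal_mul (by positivity),
    ENNReal.ofReal_mul (by positivity), ENNReal.ofReal_mul (by positivity)]
  simp only [← ofReal_norm, Real.norm_eq_abs]
  congr 3 <;> [skip; congr 2; congr 1] <;> (congr 1; push_cast; ring)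

theorem exists_nat_of_mem_Ico {h s : ℝ} (hh : 0 < h) {N : ℕ} (hs : s ∈ Ico 0 (((N : ℝ) + 1) * h)) :
    ∃ i ≤ N, s ∈ Ico ((i : ℝ) * h) (((i : ℝ) + 1) * h) := by
  refine ⟨⌊s / h⌋₊, ?_, ?_, ?_⟩
  · have : s / h < (N + 1 : ℕ) := by
      rw [div_lt_iff₀ hh]
      push_cast
      exact hs.2
    exact Nat.lt_succ_iff.1 ((Nat.floor_lt (div_nonneg hs.1 hh.le)).2 this)
  · rw [← le_div_iff₀ hh]
    exact Nat.floor_le (div_nonneg hs.1 hh.le)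
  · rw [← div_lt_iff₀ hh]
    exact Nat.lt_floor_add_one _

theorem edge_mem_convexHull {a g : Plane} {h : ℝ} (hh : 0 < h) {P Q : ℕ → Plane}
    (hP : ∀ i : ℕ, P i = a + ((i : ℝ) * h) • g) :
    ∀ i : ℕ, ∀ s ∈ Icc ((i : ℝ) * h) (((i : ℝ) + 1) * h),
      a + s • g ∈ convexHull ℝ {P i, P (i + 1), Q i} := by
  intro i s hs
  obtain ⟨σ, rfl⟩ : ∃ σ, s = σ * h := ⟨s / h, by field_simp⟩
  have hs1 := le_of_mul_le_mul_right hs.1 hh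
  have hs2 := le_of_mul_le_mul_right hs.2 hh
  refine mem_convexHull_triple (α := 1 - (σ - i)) (β := σ - i) (γ := 0)
    (by linarith) (by linarith) le_rfl (by ring) ?_
  rw [hP, hP]
  push_cast
  module

theorem Triangulation.edge_subset_closure {Ω : Set Plane} (T : Triangulation Ω) {a g : Plane} {h : ℝ}
    (hh : 0 < h) {N : ℕ} {P Q : ℕ → Plane} (hP : ∀ i : ℕ, P i = a + ((i : ℝ) * h) • g)
    (hK : ∀ i ≤ N, {P i, P (i + 1), Q i} ∈ T.elements) :
    ∀ s ∈ Icc 0 (((N : ℝ) + 1) * h), a + s • g ∈ closure Ω := by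
  have memK := edge_mem_convexHull hh hP (Q := Q)
  have hclO : ∀ s ∈ Ico 0 (((N : ℝ) + 1) * h), a + s • g ∈ closure Ω := by
    intro s hs
    obtain ⟨i, hi, hsi⟩ := exists_nat_of_mem_Ico hh hs
    exact T.convexHull_subset_closure (hK i hi) (memK i s (Ico_subset_Icc_self hsi))
  intro s hs
  rcases hs.2.eq_or_lt with h1 | h1
  · exact T.convexHull_subset_closure (hK N le_rfl) (memK N s ⟨by rw [h1]; nlinarith, h1.le⟩)
  · exact hclO s ⟨hs.1, h1⟩

/-- On the long edge of a band, a finite element function with moderate gradient is nearly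
linear. -/
theorem band_nearly_linear {Ω : Set Plane} (hΩ : interior (closure Ω) ⊆ Ω)
    (T : Triangulation Ω) {U : Plane → ℝ} (hUX : U ∈ T.femSpace)
    {G : Plane → ℝ≥0∞} (hG : Measurable G)
    (hUG : ∀ x ∈ Ω, DifferentiableAt ℝ U x → ‖gradient U x‖ₑ ≤ G x) {a g n : Plane}
    (hn : ‖n‖ = 1) (hgn : cross g n ≠ 0) {h hbar : ℝ} (hh : 0 < h) (hb : 0 < hbar) {N : ℕ}
    {P Q : ℕ → Plane} (hP : ∀ i : ℕ, P i = a + ((i : ℝ) * h) • g)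
    (hQ : ∀ i : ℕ, Q i = a + (((i : ℝ) + 1 / 2) * h) • g + hbar • n)
    (hK : ∀ i ≤ N, {P i, P (i + 1), Q i} ∈ T.elements)
    (hKt : ∀ i < N, {Q i, Q (i + 1), P (i + 1)} ∈ T.elements) {ε : ℝ}
    (hε : ENNReal.ofReal (36 / h ^ 2) *
      (∫⁻ τ in Ioc (hbar / 3) (2 * hbar / 3), ∫⁻ s in Ioc 0 (((N : ℝ) + 1) * h),
        G (a + s • g + τ • n)) ≤ ENNReal.ofReal ε) (hε0 : 0 ≤ ε) :
    ∃ t : ℝ, ∀ s s', 0 ≤ s → s ≤ s' → s' ≤ ((N : ℝ) + 1) * h →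
      |U (a + s' • g) - U (a + s • g) - t * (s' - s)| ≤ ε * (s' - s) := by
  have memK := edge_mem_convexHull hh hP (Q := Q)
  have hcl := T.edge_subset_closure hh hP hK
  obtain ⟨B, hB, hB0, hTB⟩ := T.exists_skeleton
  have hl : ∀ i : ℕ, ∃ (l : Plane →ₗ[ℝ] ℝ) (c : ℝ), i ≤ N →
      ∀ x ∈ convexHull ℝ {P i, P (i + 1), Q i}, U x = l x + c := by
    intro i
    by_cases hi : i ≤ N
    · obtain ⟨l, c, hlc⟩ := hUX.2 _ (hK i hi)
      exact ⟨l, c, fun _ => hlc⟩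
    · exact ⟨0, 0, fun h => absurd h hi⟩
  choose l c hlc using hl
  set J : ℝ → ℝ≥0∞ := fun τ => ∫⁻ s in Ioc 0 (((N : ℝ) + 1) * h), G (a + s • g + τ • n) with hJ
  obtain ⟨S, hS, hSB⟩ := finite_parallels hB hB0 a (g := n) (e := g)
    (by rwa [cross_swap, neg_ne_zero])
  have slice : ∀ τ ∈ Ioc (hbar / 3) (2 * hbar / 3), τ ∉ S → ∀ i ≤ N,
      ‖l i g - l 0 g‖ₑ ≤ ENNReal.ofReal (12 * hbar / h ^ 2) * J τ := by
    intro τ hτ hτS i hi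
    obtain ⟨R, hR, hRB⟩ := hSB τ hτS
    have ind : ∀ i ≤ N, ‖l i g - l 0 g‖ₑ ≤ ENNReal.ofReal (12 * hbar / h ^ 2) *
        ∫⁻ s in Ioc (1 / 2 * h) (((i : ℝ) + 1 / 2) * h), G (a + τ • n + s • g) := by
      intro i
      induction i with
      | zero => simp
      | succ i ih =>
        intro hi
        obtain ⟨lt, ct, hlt⟩ := hUX.2 _ (hKt i (by omega))
        have step := band_slope_step hΩ T hTB hG hUG hn hh hb hτ hR hRB hP hQ
          (hK i (by omega)) (hK (i + 1) hi) (hKt i (by omega)) (hlc i (by omega))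
          (hlc (i + 1) hi) hlt
        have h0 := ih (by omega)
        have hi0 : (0 : ℝ) ≤ i := Nat.cast_nonneg i
        calc ‖l (i + 1) g - l 0 g‖ₑ = ‖(l i g - l 0 g) + (l (i + 1) g - l i g)‖ₑ := by
              congr 1; ring
          _ ≤ ‖l i g - l 0 g‖ₑ + ‖l (i + 1) g - l i g‖ₑ := enorm_add_le _ _
          _ ≤ _ := add_le_add h0 step
          _ = _ := by
            rw [← mul_add, ← lintegral_union measurableSet_Ioc (Ioc_disjoint_Ioc_of_le le_rfl),
              Ioc_union_Ioc_eq_Ioc (by nlinarith) (by push_cast; nlinarith)]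
    refine (ind i hi).trans ?_
    have hiN : (i : ℝ) ≤ N := Nat.cast_le.2 hi
    simp only [hJ, add_right_comm a _ (τ • n)]
    gcongr
    · linarith
    · linarith
  -- Averaging over the heights in an interval of length `hbar / 3` turns the factor `12 hbar / h²`
  -- into `36 / h²`.
  have hslope : ∀ i ≤ N, |l i g - l 0 g| ≤ ε := by
    intro i hi
    rw [← ENNReal.ofReal_le_ofReal_iff hε0]
    refine le_trans ?_ hε
    have hJm : Measurable J := by
      have hF : Measurable fun z : ℝ × ℝ => G (a + z.1 • g + z.2 • n) :=
        hG.comp (by fun_prop)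
      exact hF.lintegral_prod_left'
    have h1 : ENNReal.ofReal (hbar / 3) * ‖l i g - l 0 g‖ₑ ≤
        ENNReal.ofReal (12 * hbar / h ^ 2) * ∫⁻ τ in Ioc (hbar / 3) (2 * hbar / 3), J τ := by
      rw [← lintegral_const_mul _ hJm]
      calc ENNReal.ofReal (hbar / 3) * ‖l i g - l 0 g‖ₑ
          = ∫⁻ _τ in Ioc (hbar / 3) (2 * hbar / 3), ‖l i g - l 0 g‖ₑ := by
            rw [setLIntegral_const, Real.volume_Ioc, mul_comm]
            congr 2
            ring
        _ ≤ _ := by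
          refine setLIntegral_mono_ae (by fun_prop) ?_
          filter_upwards [hS.countable.ae_notMem volume] with τ hτS hτ
          exact slice τ hτ hτS i hi
    calc ENNReal.ofReal |l i g - l 0 g|
        = ENNReal.ofReal (3 / hbar) * (ENNReal.ofReal (hbar / 3) * ‖l i g - l 0 g‖ₑ) := by
          rw [← mul_assoc, ← ENNReal.ofReal_mul (by positivity), ← ofReal_norm, Real.norm_eq_abs]
          field_simp
          simp
      _ ≤ ENNReal.ofReal (3 / hbar) * (ENNReal.ofReal (12 * hbar / h ^ 2) *
          ∫⁻ τ in Ioc (hbar / 3) (2 * hbar / 3), J τ) := by gcongr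
      _ = _ := by
        rw [← mul_assoc, ← ENNReal.ofReal_mul (by positivity)]
        congr 2
        field_simp
        norm_num
  refine ⟨l 0 g, fun s s' hs hss hs' => ?_⟩
  have hcont : ContinuousOn (fun σ : ℝ => U (a + σ • g) - l 0 g * σ) (Icc s s') := by
    refine ContinuousOn.sub (hUX.1.comp (by fun_prop) fun σ hσ => ?_) (by fun_prop)
    exact hcl σ ⟨hs.trans hσ.1, hσ.2.trans hs'⟩
  -- Right derivatives exist also at the vertices `P i`, so the mean value inequality applies across
  -- the whole edge at once.
  have hder : ∀ σ ∈ Ico s s', ∃ d, |d| ≤ ε ∧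
      HasDerivWithinAt (fun σ : ℝ => U (a + σ • g) - l 0 g * σ) d (Ici σ) σ := by
    intro σ hσ
    obtain ⟨i, hi, hσi⟩ := exists_nat_of_mem_Ico hh
      (⟨hs.trans hσ.1, hσ.2.trans_le hs'⟩ : σ ∈ Ico 0 (((N : ℝ) + 1) * h))
    refine ⟨l i g - l 0 g, hslope i hi, ?_⟩
    have h1 : HasDerivAt (fun σ : ℝ => l i a + c i + (l i g - l 0 g) * σ) (l i g - l 0 g) σ := by
      simpa using ((hasDerivAt_id σ).const_mul (l i g - l 0 g)).const_add (l i a + c i)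
    have h2 : ∀ x ∈ Ico σ (((i : ℝ) + 1) * h),
        U (a + x • g) - l 0 g * x = l i a + c i + (l i g - l 0 g) * x := by
      intro x hx
      rw [hlc i hi _ (memK i x ⟨hσi.1.trans hx.1, hx.2.le⟩)]
      simp only [map_add, map_smul, smul_eq_mul]
      ring
    refine h1.hasDerivWithinAt.congr_of_eventuallyEq ?_ (h2 σ ⟨le_rfl, hσi.2⟩)
    filter_upwards [Ico_mem_nhdsGE hσi.2] with x hx using h2 x hx
  choose! d hd1 hd2 using hder
  have := norm_image_sub_le_of_norm_deriv_right_le_segment hcont hd2 hd1 s' ⟨hss, le_rfl⟩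
  rw [Real.norm_eq_abs] at this
  convert this using 2
  ring

/-! ### The error for the quadratic solution -/

theorem Triangulation.IsFEMSolution.mem_femSpace {Ω : Set Plane} {T : Triangulation Ω}
    {f g U : Plane → ℝ} (hg : g ∈ T.femSpace) (hU : T.IsFEMSolution f g U) : U ∈ T.femSpace := by
  obtain ⟨⟨U₀, ⟨hU₀, -⟩, hsum⟩, -⟩ := hU
  refine ⟨(hU₀.1.add hg.1).congr fun x _ => hsum x, fun K hK => ?_⟩
  obtain ⟨l, c, hlc⟩ := hU₀.2 K hK
  obtain ⟨l', c', hlc'⟩ := hg.2 K hK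
  refine ⟨l + l', c + c', fun x hx => ?_⟩
  rw [hsum, hlc x hx, hlc' x hx, LinearMap.add_apply]
  ring

theorem quadSol_eq_norm_sq (x : Plane) : quadSol x = ‖x‖ ^ 2 := by
  rw [EuclideanSpace.real_norm_sq_eq, Fin.sum_univ_two, quadSol]

theorem hasGradientAt_quadSol (x : Plane) : HasGradientAt quadSol ((2 : ℝ) • x) x := by
  rw [funext quadSol_eq_norm_sq, hasGradientAt_iff_hasFDerivAt]
  have := (hasStrictFDerivAt_norm_sq x).hasFDerivAt
  refine this.congr_fderiv ?_
  ext y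
  simp

theorem abs_cross_eq_one {g n : Plane} (hg : ‖g‖ = 1) (hn : ‖n‖ = 1) (hgn : inner ℝ g n = 0) :
    |cross g n| = 1 := by
  have h1 := EuclideanSpace.real_norm_sq_eq g
  have h2 := EuclideanSpace.real_norm_sq_eq n
  have h3 : n 0 * g 0 + n 1 * g 1 = 0 := by
    simpa [PiLp.inner_apply, Fin.sum_univ_two] using hgn
  rw [hg, Fin.sum_univ_two] at h1
  rw [hn, Fin.sum_univ_two] at h2
  refine (sq_eq_sq₀ (abs_nonneg _) zero_le_one).1 ?_
  rw [sq_abs, cross]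
  linear_combination (-(n 0 ^ 2 + n 1 ^ 2)) * h1 - h2 - (n 0 * g 0 + n 1 * g 1) * h3

theorem Triangulation.differentiableAt_quadSol_sub {Ω : Set Plane} (T : Triangulation Ω)
    {U : Plane → ℝ} (hU : U ∈ T.femSpace) {B : Set (Plane →ᵃ[ℝ] ℝ)}
    (hTB : ∀ K ∈ T.elements, ∀ x ∈ convexHull ℝ K, (∀ f ∈ B, f x ≠ 0) → convexHull ℝ K ∈ 𝓝 x)
    {x : Plane} (hx : x ∈ Ω) (hxB : ∀ f ∈ B, f x ≠ 0) :
    DifferentiableAt ℝ (fun x => quadSol x - U x) x := by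
  have hx' := subset_closure hx
  rw [← T.cover] at hx'
  obtain ⟨K, hK, hxK⟩ := mem_iUnion₂.1 hx'
  obtain ⟨l, c, hlc⟩ := hU.2 K hK
  exact (hasGradientAt_quadSol x).differentiableAt.sub
    (hasGradientAt_of_eqOn_affine hlc (hTB K hK x hxK hxB)).1

/-- If the error in the energy seminorm is at most `1`, then the finite element function is nearly
linear on the long edge of a flat band. -/
theorem band_nearly_linear_of_h1Seminorm_le_one {Ω : Set Plane} (hO : IsOpen Ω)
    (hΩ : interior (closure Ω) ⊆ Ω) {R : ℝ} (hR : 0 ≤ R) (hΩR : ∀ x ∈ closure Ω, ‖x‖ ≤ R)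
    (T : Triangulation Ω) {U : Plane → ℝ} (hUX : U ∈ T.femSpace)
    (hE : h1Seminorm Ω (fun x => quadSol x - U x) ≤ 1) {a g n : Plane} (hg : ‖g‖ = 1)
    (hn : ‖n‖ = 1) (hgn : inner ℝ g n = 0) {h hbar : ℝ} (hh : 0 < h) (hb : 0 < hbar) {N : ℕ}
    {P Q : ℕ → Plane} (hP : ∀ i : ℕ, P i = a + ((i : ℝ) * h) • g)
    (hQ : ∀ i : ℕ, Q i = a + (((i : ℝ) + 1 / 2) * h) • g + hbar • n)
    (hK : ∀ i ≤ N, {P i, P (i + 1), Q i} ∈ T.elements)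
    (hKt : ∀ i < N, {Q i, Q (i + 1), P (i + 1)} ∈ T.elements) :
    ∃ t : ℝ, ∀ s s', 0 ≤ s → s ≤ s' → s' ≤ ((N : ℝ) + 1) * h →
      |U (a + s' • g) - U (a + s • g) - t * (s' - s)| ≤
        36 / h ^ 2 * (√(2 * R * (hbar / 3)) + 2 * R * (2 * R * (hbar / 3))) * (s' - s) := by
  set w : Plane → ℝ := fun x => quadSol x - U x with hw
  set G₀ := Ω.indicator fun x => ‖gradient w x‖ₑ with hG₀
  have hG₀m : Measurable G₀ := measurable_indicator_enorm_gradient hO.measurableSet w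
  have hc := abs_cross_eq_one hg hn hgn
  have hc0 : cross g n ≠ 0 := by
    intro h0
    simp [h0] at hc
  have hlen : ((N : ℝ) + 1) * h ≤ 2 * R := by
    have hcl := T.edge_subset_closure hh hP hK
    have h0 := hΩR _ (hcl 0 ⟨le_rfl, by positivity⟩)
    have h1 := hΩR _ (hcl _ ⟨by positivity, le_rfl⟩)
    rw [zero_smul, add_zero] at h0
    calc ((N : ℝ) + 1) * h = ‖(a + (((N : ℝ) + 1) * h) • g) - a‖ := by
          rw [add_sub_cancel_left, norm_smul, hg, Real.norm_of_nonneg (by positivity), mul_one]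
      _ ≤ R + R := (norm_sub_le _ _).trans (add_le_add h1 h0)
      _ = 2 * R := by ring
  -- The majorant comes from `∇U = ∇u - ∇w` and `|∇u| = 2|x| ≤ 2R`. The middle third of the band has
  -- parameter area at most `2R · hbar / 3`: the first summand contributes its square root by
  -- Cauchy–Schwarz, the second `2R` times it.
  refine band_nearly_linear hΩ T hUX (G := fun x => G₀ x + ENNReal.ofReal (2 * R))
    (hG₀m.add_const _) ?_ hn hc0 hh hb hP hQ hK hKt ?_ (by positivity)
  · intro x hx hdU
    have hdw : DifferentiableAt ℝ w x := (hasGradientAt_quadSol x).differentiableAt.sub hdU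
    have hgrad : gradient U x = (2 : ℝ) • x - gradient w x := by
      have h1 := hdw.hasGradientAt.hasFDerivAt
      have h2 := (hasGradientAt_quadSol x).hasFDerivAt.sub h1
      have h3 : (fun y => quadSol y - w y) = U := by
        funext y
        simp [hw]
      have h4 : HasGradientAt U ((2 : ℝ) • x - gradient w x) x := by
        rw [hasGradientAt_iff_hasFDerivAt, map_sub, ← h3]
        exact h2
      exact h4.gradient
    rw [hgrad, hG₀, indicator_of_mem hx]
    refine enorm_sub_le.trans ?_
    rw [add_comm]
    gcongr
    rw [← ofReal_norm, norm_smul]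
    refine ENNReal.ofReal_le_ofReal ?_
    have := hΩR x (subset_closure hx)
    norm_num
    exact this
  · have h1 := lintegral_parallelogram_le hO.measurableSet w a hc0 0 (((N : ℝ) + 1) * h)
      (hbar / 3) (2 * hbar / 3)
    have hJm : Measurable fun τ : ℝ => ∫⁻ s in Ioc 0 (((N : ℝ) + 1) * h),
        G₀ (a + s • g + τ • n) := by
      have hF : Measurable fun z : ℝ × ℝ => G₀ (a + z.1 • g + z.2 • n) :=
        hG₀m.comp (by fun_prop)
      exact hF.lintegral_prod_left'
    rw [ENNReal.ofReal_mul (p := 36 / h ^ 2) (by positivity)]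
    gcongr
    simp_rw [lintegral_add_right _ (measurable_const (a := ENNReal.ofReal (2 * R)))]
    rw [lintegral_add_right _ measurable_const]
    rw [ENNReal.ofReal_add (by positivity) (by positivity)]
    rw [show 2 * hbar / 3 - hbar / 3 = hbar / 3 by ring, sub_zero, hc] at h1
    gcongr
    · refine h1.trans ?_
      rw [Real.sqrt_eq_rpow, ← ENNReal.ofReal_rpow_of_nonneg (by positivity) (by positivity),
        ENNReal.ofReal_mul (p := 2 * R) (by positivity)]
      calc _ ≤ (ENNReal.ofReal 1⁻¹ * (1 : ℝ≥0∞) ^ (2 : ℝ)) ^ (1 / 2 : ℝ) *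
            (ENNReal.ofReal (2 * R) * ENNReal.ofReal (hbar / 3)) ^ (1 / 2 : ℝ) := by gcongr
        _ = _ := by simp
    · rw [setLIntegral_const, setLIntegral_const, Real.volume_Ioc, Real.volume_Ioc, sub_zero,
        ENNReal.ofReal_mul (p := 2 * R) (by positivity),
        ENNReal.ofReal_mul (p := 2 * R) (by positivity),
        show 2 * hbar / 3 - hbar / 3 = hbar / 3 by ring, mul_assoc]
      gcongr

theorem quadSol_second_difference {a g : Plane} (hg : ‖g‖ = 1) (s m : ℝ) :
    quadSol (a + s • g) - 2 * quadSol (a + (s + m) • g) + quadSol (a + (s + 2 * m) • g) =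
      2 * m ^ 2 := by
  have h1 := EuclideanSpace.real_norm_sq_eq g
  rw [hg, Fin.sum_univ_two] at h1
  simp only [quadSol, PiLp.add_apply, PiLp.smul_apply, smul_eq_mul]
  linear_combination (-2 * m ^ 2) * h1

/-- The linear part `t` cancels in the second difference of `U`, leaving at most `2εm ≤ m²` against
the `2m²` of the quadratic. -/
theorem sq_le_abs_second_difference {U : Plane → ℝ} {a g : Plane} (hg : ‖g‖ = 1) {L ε t : ℝ}
    (hU : ∀ s s', 0 ≤ s → s ≤ s' → s' ≤ L →
      |U (a + s' • g) - U (a + s • g) - t * (s' - s)| ≤ ε * (s' - s))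
    {s m : ℝ} (hs : 0 ≤ s) (hm : 0 < m) (hsL : s + 2 * m ≤ L) (hε : ε ≤ m / 2) :
    m ^ 2 ≤ |(quadSol (a + s • g) - U (a + s • g)) -
      2 * (quadSol (a + (s + m) • g) - U (a + (s + m) • g)) +
      (quadSol (a + (s + 2 * m) • g) - U (a + (s + 2 * m) • g))| := by
  have h0 := quadSol_second_difference (a := a) hg s m
  have h1 := (abs_le.1 (hU s (s + m) hs (by linarith) (by linarith))).1
  have h2 := (abs_le.1 (hU (s + m) (s + 2 * m) (by linarith) (by linarith) hsL)).2
  have h3 : ε * m ≤ m / 2 * m := by gcongr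
  refine le_trans ?_ (le_abs_self _)
  rw [show s + 2 * m - (s + m) = m by ring] at h2
  rw [show s + m - s = m by ring] at h1
  nlinarith

/-- The exponent `4` enters here, through `√hbar / h² = √(hbar / h⁴)`; the other term is of order
`hbar / h²`, hence smaller still. -/
theorem tendsto_band_defect {h hbar : ℕ → ℝ} (hpos : ∀ k, 0 < h k) (hlim : Tendsto h atTop (𝓝 0))
    (hsmall : hbar =o[atTop] fun k => h k ^ 4) (R : ℝ) :
    Tendsto (fun k => 36 / h k ^ 2 *
      (√(2 * R * (hbar k / 3)) + 2 * R * (2 * R * (hbar k / 3)))) atTop (𝓝 0) := by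
  have hρ : Tendsto (fun k => hbar k / h k ^ 4) atTop (𝓝 0) := hsmall.tendsto_div_nhds_zero
  have h1 : Tendsto (fun k => 36 * (√(2 * R / 3 * (hbar k / h k ^ 4)) +
      4 * R ^ 2 / 3 * (hbar k / h k ^ 4) * h k ^ 2)) atTop
      (𝓝 (36 * (√(2 * R / 3 * 0) + 4 * R ^ 2 / 3 * 0 * 0 ^ 2))) :=
    (((hρ.const_mul _).sqrt).add ((hρ.const_mul _).mul (hlim.pow 2))).const_mul _
  simp only [mul_zero, Real.sqrt_zero, zero_mul, add_zero] at h1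
  refine h1.congr fun k => ?_
  have hk := hpos k
  have h2 : √(2 * R * (hbar k / 3)) = √(2 * R / 3 * (hbar k / h k ^ 4)) * h k ^ 2 := by
    rw [← Real.sqrt_sq (by positivity : 0 ≤ h k ^ 2), ← Real.sqrt_mul' _ (by positivity)]
    congr 1
    field_simp
  rw [h2]
  field_simp
  ring

/-! ### The contradiction -/

theorem mainTheorem5
    (Ω : Set Plane) (hΩ : IsPolygonalDomain Ω)
    -- the family of triangulations, indexed by the mesh size
    (h₀ : ℝ) (hh₀ : 0 < h₀) (T : ℝ → Triangulation Ω)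
    (hT : ∀ h ∈ Ioo 0 h₀, (T h).HasMeshSize h)
    -- the sequence of bands
    (C_L : ℝ) (hC_L : 0 < C_L)
    (h hbar : ℕ → ℝ) (N : ℕ → ℕ)
    (hh : ∀ k, h k ∈ Ioo 0 h₀) (hh_lim : Tendsto h atTop (𝓝 0))
    (hbar_pos : ∀ k, 0 < hbar k)
    (hband : ∀ k, (T (h k)).ContainsBand (h k) (hbar k) (N k))
    (hL : ∀ k, C_L ≤ ((N k : ℝ) + 1) * h k)
    (hbar_small : hbar =o[atTop] fun k => h k ^ 4)
    -- arbitrary discrete Dirichlet lifts and the corresponding finite element solutions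
    (g U : ℝ → Plane → ℝ)
    (hg : ∀ h ∈ Ioo 0 h₀, g h ∈ (T h).femSpace)
    (hU : ∀ h ∈ Ioo 0 h₀, (T h).IsFEMSolution (fun _ => -4) (g h) (U h)) :
    ¬ Tendsto (fun h => h1Seminorm Ω (fun x => quadSol x - U h x)) (𝓝[>] 0) (𝓝 0) := by
  intro hconv
  have hO := hΩ.isOpen
  have hint := hΩ.lipschitz.interior_closure_subset hO
  set w : ℕ → Plane → ℝ := fun k x => quadSol x - U (h k) x with hw
  have hpos : ∀ k, 0 < h k := fun k => (hh k).1
  have hE : Tendsto (fun k => h1Seminorm Ω (w k)) atTop (𝓝 0) :=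
    hconv.comp (tendsto_nhdsWithin_iff.2 ⟨hh_lim, Eventually.of_forall hpos⟩)
  have hUX : ∀ k, U (h k) ∈ (T (h k)).femSpace := fun k => (hU _ (hh k)).mem_femSpace (hg _ (hh k))
  have hcomp : IsCompact (closure Ω) := hΩ.isBounded.isCompact_closure
  obtain ⟨R, hR0, hR⟩ : ∃ R, 0 ≤ R ∧ ∀ x ∈ closure Ω, ‖x‖ ≤ R := by
    obtain ⟨R, hR, hR'⟩ := hcomp.isBounded.exists_pos_norm_le
    exact ⟨R, hR.le, hR'⟩
  choose a γ n hγ hn hγn P Q hP hQ hK hKt using hband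
  have hcl : ∀ k, ∀ s ∈ Icc 0 C_L, a k + s • γ k ∈ closure Ω := fun k s hs =>
    (T (h k)).edge_subset_closure (hpos k) (hP k) (hK k) s ⟨hs.1, hs.2.trans (hL k)⟩
  -- The bands may move with `k`. Along a subsequence their base points and directions converge, and
  -- a transversal direction for the limit segment serves all late bands.
  obtain ⟨⟨a', γ'⟩, ⟨-, hγ'⟩, φ, hφ, hlim⟩ :=
    (hcomp.prod (isCompact_sphere (0 : Plane) 1)).tendsto_subseq
      (x := fun k => (a k, γ k)) fun k =>
        ⟨by simpa using hcl k 0 ⟨le_rfl, hC_L.le⟩, by simpa using hγ k⟩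
  have hφ' := hφ.tendsto_atTop
  have ha : Tendsto (fun k => a (φ k)) atTop (𝓝 a') := (continuous_fst.tendsto _).comp hlim
  have hγlim : Tendsto (fun k => γ (φ k)) atTop (𝓝 γ') := (continuous_snd.tendsto _).comp hlim
  have hpt : ∀ s : ℝ, Tendsto (fun k => a (φ k) + s • γ (φ k)) atTop (𝓝 (a' + s • γ')) :=
    fun s => ha.add (hγlim.const_smul s)
  obtain ⟨s₀, hs₀, e, r, hr, he, hcross, hdir⟩ := hΩ.lipschitz.exists_direction hO
    (a := a') (g := γ') (by simpa using hγ') hC_L fun s hs =>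
      isClosed_closure.mem_of_tendsto (hpt s)
        (Eventually.of_forall fun k => hcl _ s (Ioo_subset_Icc_self hs))
  -- The side of length `3m` starting at `s₀` must stay on the band's edge and within `r / 2` of its
  -- starting point; the remaining `r / 2` absorbs the distance to the limit segment.
  obtain ⟨m, hm, hm1, hm2⟩ : ∃ m : ℝ, 0 < m ∧ s₀ + 3 * m ≤ C_L ∧ 3 * m < r / 2 := by
    have h1 := sub_pos.2 hs₀.2
    refine ⟨min (C_L - s₀) r / 8, by positivity, ?_, ?_⟩
    · linarith [min_le_left (C_L - s₀) r]
    · linarith [min_le_right (C_L - s₀) r]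
  -- Half the limiting determinant bounds the determinants of the late parallelograms from below, so
  -- the Jacobian factor is uniform in `k`.
  set d := |cross γ' e| / 2 with hd
  have hd0 : 0 < d := by positivity
  have hcrosslim : Tendsto (fun k => |cross (γ (φ k)) e|) atTop (𝓝 |cross γ' e|) := by
    have : Continuous fun v : Plane => |cross v e| := by
      unfold cross
      fun_prop
    exact (this.tendsto _).comp hγlim
  -- The left-hand side is positive and independent of `k`, while the right-hand side is a constant
  -- times the error seminorm.
  have hbound : ∀ᶠ k in atTop,
      ENNReal.ofReal (m ^ 2) * ENNReal.ofReal m * ENNReal.ofReal (r / 2) ≤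
        (ENNReal.ofReal m + 4 * ENNReal.ofReal (r / 2)) *
        ((ENNReal.ofReal d⁻¹ * h1Seminorm Ω (w (φ k)) ^ (2 : ℝ)) ^ (1 / 2 : ℝ) *
        (ENNReal.ofReal (3 * m) * ENNReal.ofReal (r / 2)) ^ (1 / 2 : ℝ)) := by
    filter_upwards [hcrosslim.eventually_const_le (by rw [hd]; linarith : d < |cross γ' e|),
      (hE.comp hφ').eventually_le_const (zero_lt_one),
      ((tendsto_band_defect hpos hh_lim hbar_small R).comp hφ').eventually_le_const
        (by positivity : 0 < m / 2),
      (hpt s₀).eventually (Metric.ball_mem_nhds _ (by positivity : 0 < r / 2))]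
      with k hk1 hk2 hk3 hk4
    obtain ⟨t, ht⟩ := band_nearly_linear_of_h1Seminorm_le_one hO hint hR0 hR (T (h (φ k)))
      (hUX _) hk2 (hγ _) (hn _) (hγn _) (hpos _) (hbar_pos _) (hP _) (hQ _) (hK _) (hKt _)
    obtain ⟨B, hB, hB0, hTB⟩ := (T (h (φ k))).exists_skeleton
    have hc0 : cross (γ (φ k)) e ≠ 0 := fun h0 => by
      rw [h0, abs_zero] at hk1
      linarith
    have hcont : ContinuousOn (w (φ k)) (closure Ω) := by
      refine ContinuousOn.sub (Continuous.continuousOn ?_) (hUX (φ k)).1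
      unfold quadSol
      fun_prop
    set p := a (φ k) + s₀ • γ (φ k) with hp
    have hpcl : ∀ s ∈ Icc 0 (3 * m), p + s • γ (φ k) ∈ closure Ω := by
      intro s hs
      rw [hp, add_assoc, ← add_smul]
      exact hcl _ _ ⟨add_nonneg hs₀.1.le hs.1, by linarith [hs.2]⟩
    have hpin : ∀ s ∈ Icc 0 (3 * m), ∀ τ ∈ Ioc 0 (r / 2), p + s • γ (φ k) + τ • e ∈ Ω := by
      intro s hs τ hτ
      refine hdir _ (hpcl s hs) ?_ τ ⟨hτ.1, by linarith [hτ.2]⟩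
      rw [Metric.mem_ball]
      calc dist (p + s • γ (φ k)) (a' + s₀ • γ')
          ≤ dist (p + s • γ (φ k)) p + dist p (a' + s₀ • γ') := dist_triangle _ _ _
        _ < r / 2 + r / 2 := by
          refine add_lt_add ?_ hk4
          rw [dist_eq_norm, add_sub_cancel_left, norm_smul, hγ, mul_one,
            Real.norm_of_nonneg hs.1]
          exact hs.2.trans_lt hm2
        _ = r := by ring
    have key := second_difference_le_lintegral hO hcont hB hB0
      (fun x hx hxB => (T (h (φ k))).differentiableAt_quadSol_sub (hUX _) hTB hx hxB)
      (hγ (φ k)) he hc0 hm hpcl hpin (c := ENNReal.ofReal (m ^ 2)) (by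
        intro s hs
        rw [← ofReal_norm]
        refine ENNReal.ofReal_le_ofReal ?_
        rw [Real.norm_eq_abs, hp]
        simp only [add_assoc (a (φ k)), ← add_smul, ← add_assoc s₀]
        exact sq_le_abs_second_difference (hγ _) ht (add_nonneg hs₀.1.le hs.1) hm
          (le_trans (by linarith [hs.2]) (hL (φ k))) hk3)
    refine key.trans ?_
    gcongr
    refine (lintegral_parallelogram_le hO.measurableSet (w (φ k)) p hc0 0 (3 * m) 0
      (r / 2)).trans ?_
    rw [sub_zero, sub_zero]
    gcongr
  have hlim0 : Tendsto (fun k => (ENNReal.ofReal m + 4 * ENNReal.ofReal (r / 2)) *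
        ((ENNReal.ofReal d⁻¹ * h1Seminorm Ω (w (φ k)) ^ (2 : ℝ)) ^ (1 / 2 : ℝ) *
        (ENNReal.ofReal (3 * m) * ENNReal.ofReal (r / 2)) ^ (1 / 2 : ℝ))) atTop (𝓝 0) := by
    have h1 : Tendsto (fun k => h1Seminorm Ω (w (φ k)) ^ (2 : ℝ)) atTop (𝓝 0) := by
      simpa using (hE.comp hφ').ennrpow_const 2
    have h2 := (ENNReal.Tendsto.const_mul h1 (Or.inr (ENNReal.ofReal_ne_top (r := d⁻¹)))).ennrpow_const
      (1 / 2 : ℝ)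
    have h3 : (ENNReal.ofReal (3 * m) * ENNReal.ofReal (r / 2)) ^ (1 / 2 : ℝ) ≠ ⊤ := by
      refine ENNReal.rpow_ne_top_of_nonneg (by norm_num) ?_
      exact ENNReal.mul_ne_top ENNReal.ofReal_ne_top ENNReal.ofReal_ne_top
    have h4 : ENNReal.ofReal m + 4 * ENNReal.ofReal (r / 2) ≠ ⊤ :=
      ENNReal.add_ne_top.2 ⟨ENNReal.ofReal_ne_top,
        ENNReal.mul_ne_top (by norm_num) ENNReal.ofReal_ne_top⟩
    have h5 := ENNReal.Tendsto.const_mul (ENNReal.Tendsto.mul_const h2 (Or.inr h3)) (Or.inr h4)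
    simpa using h5
  have hle := ge_of_tendsto hlim0 hbound
  have hgt : 0 < ENNReal.ofReal (m ^ 2) * ENNReal.ofReal m * ENNReal.ofReal (r / 2) := by
    rw [← ENNReal.ofReal_mul (by positivity), ← ENNReal.ofReal_mul (by positivity)]
    exact ENNReal.ofReal_pos.2 (by positivity)
  exact absurd hle (not_le.2 hgt)
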